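/- Let $\mathbb{C}^n$ carry the infinity norm $|\cdot|$, let $D_0\subset\mathbb{C}^n$ be a non-empty set (possibly contained in $\mathbb{R}^n$), and for $r>0$ let $D_r=\{z\in\mathbb{C}^n:\operatorname{dist}(z,D_0)<r\}$ be its complex $r$-neighbourhood. For a function $g$ write $\|g\|_D=\sup_{x\in D}|g(x)|$. Let $\delta>0$, let $f:D_\delta\to\mathbb{C}^n$ be analytic, put $\varepsilon=\|f-\mathrm{id}\|_{D_\delta}$, and suppose that $\varepsilon/\delta\le \frac1{6\mathrm e}$. Define the finite differences by $\Delta_0(x)=x$, $\Delta_k(x)=\Delta_{k-1}(f(x))-\Delta_{k-1}(x)$ for $k\ge1$, and the interpolating vector field of order $m$ by $$X_m(x)=\sum_{k=1}^m\frac{(-1)^{k-1}}{k}\Delta_k(x).$$ Let $M_\varepsilon=\frac{\delta}{6\mathrm e\varepsilon}$ (with $M_\varepsilon=+\infty$ if $\varepsilon=0$), and let $\Phi^t_X$ denote the flow of the differential equation $\dot x=X(x)$. Then for every integer $m$ with $2\le m\le M_\varepsilon+1$ the following hold. For each $x\in D_{\delta/3}$ the iterates $x,f(x),\dots,f^{m-1}(x)$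 are defined and lie in $D_\delta$, so that $X_m$ is defined on $D_{\delta/3}$; the vector field $X_m$ is analytic in $D_{\delta/3}$ and $\|X_m\|_{D_{\delta/3}}\le2\varepsilon$; for every initial condition in $D_0$ the equation $\dot x=X_m(x)$ in $D_{\delta/3}$ has a unique solution on $[0,1]$, so that $\Phi^1_{X_m}$ is defined on $D_0$; and $$\|\Phi^1_{X_m}-f\|_{D_0}\le3\varepsilon\left(\frac{6(m-1)\varepsilon}{\delta}\right)^m.$$ Moreover, if $\varepsilon\neq0$, then $m=\lfloor M_\varepsilon\rfloor+1$ lies in this range, and for this $m$ $$\|\Phi^1_{X_m}-f\|_{D_0}\le3\varepsilon\exp\left(-\frac{\delta}{6\mathrm e\varepsilon}\right).$$ -/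

import Mathlib

/-- The iterated finite differences of a map `f`:
`Δ₀(x) = x` and `Δ_{k+1}(x) = Δ_k(f(x)) - Δ_k(x)`. -/
def finiteDiff {E : Type*} [AddCommGroup E] (f : E → E) : ℕ → E → E
  | 0, x => x
  | k + 1, x => finiteDiff f k (f x) - finiteDiff f k x

/-- The interpolating vector field of order `m`:
`X_m(x) = ∑_{k=1}^m ((-1)^(k-1) / k) Δ_k(x)`. -/
noncomputable def interpField {E : Type*} [AddCommGroup E] [Module ℂ E]
    (f : E → E) (m : ℕ) (x : E) : E :=
  ∑ k ∈ Finset.Icc 1 m, ((-1 : ℂ) ^ (k - 1) / (k : ℂ)) • finiteDiff f k x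

/-- `γ` solves `ẋ = X(x)` on the time interval `[0, T]` with `γ 0 = x`, staying in the
domain `U` of the vector field. -/
def IsSolution {E : Type*} [NormedAddCommGroup E] [NormedSpace ℝ E]
    (X : E → E) (U : Set E) (T : ℝ) (x : E) (γ : ℝ → E) : Prop :=
  γ 0 = x ∧ ∀ t ∈ Set.Icc 0 T,
    γ t ∈ U ∧ HasDerivWithinAt γ (X (γ t)) (Set.Icc 0 T) t

/-- `Φ` is the flow of the vector field `X` on the domain `U`, for initial conditions in `S`
and times in `[0, T]`: every `t ↦ Φ t x` with `x ∈ S` solves `ẋ = X(x)` on `[0, T]` inside `U`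
starting from `x`, and every solution inside `U` starting from `x` coincides with it as long as
it is defined. -/
def IsFlow {E : Type*} [NormedAddCommGroup E] [NormedSpace ℝ E]
    (X : E → E) (U S : Set E) (T : ℝ) (Φ : ℝ → E → E) : Prop :=
  ∀ x ∈ S, IsSolution X U T x (fun t => Φ t x) ∧
    ∀ T' ∈ Set.Icc 0 T, ∀ γ : ℝ → E, IsSolution X U T' x γ →
      Set.EqOn γ (fun t => Φ t x) (Set.Icc 0 T')

/-!
Everything is local: if `x ∈ D₀`, then `f` is analytic on the ball `ball x δ` and moves its points
by at most `ε`, and the solution of `ẏ = X_m(y)` starting at `x` stays in `ball x (δ / 3)`.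

*Size of the vector field.* The Schwarz lemma on balls of radius `σ` gives
`sup ‖Δ_{k+1}‖ ≤ (2ε / σ) sup ‖Δ_k‖` for `k ≥ 1`, at the cost of shrinking the domain by `σ`. Splitting the
layer between the radii `δ / 3` and `δ` into `m - 1` equal parts yields
`‖Δ_{k+1}‖ ≤ ε (3(m-1)ε / δ) ^ k ≤ ε / 2 ^ k` if `6(m-1)ε ≤ δ` (`norm_finiteDiff_succ_le_third`), hence
`‖X_m‖ ≤ 2ε` (`norm_interpField_le`). In particular solutions exist on `[0, 1]`.

*Order of contact.* The Newton polynomial `P(t) = ∑_{k ≤ m} binom(t, k) Δ_k(x)` satisfies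
`P(j) = f^j(x)` for `j ≤ m` and `P'(0) = X_m(x)`. Moving time by one replaces `x` by `f(x)` up to a
multiple of `Δ_{m+1}` (`newtonCurve_add_one`), so the defect `P' - X_m(P)` is `O(ε ^ (m+1))` at the
`m + 1` nodes `0, …, m`; it is also bounded on a disc of radius comparable to `1 / ε`. By
interpolation (`exists_norm_le_of_norm_le_at_nodes`) it is `O(ε ^ (m+1))` on `[0, 1]`, and
Gronwall's inequality gives `Φ¹(x) - f(x) = O(ε ^ (m+1))` with an unspecified constant
(`exists_norm_solution_sub_le`).

*The sharp constant.* Put `f_μ = id + μ (f - id)` for complex `|μ| < R = δ / (6(m-1)ε)`. The previous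
estimates apply to `f_μ` with `|μ| ε` in place of `ε`. The error `ψ(μ)` of the time-one map at `x` is
holomorphic in `μ` (`differentiableOn_solution_one`: it is a uniform limit of Euler polygons),
bounded by `2εR + εR = 3εR`, and `O(μ ^ (m+1))` at the origin. The Schwarz lemma of order `m + 1`
at `μ = 1` gives `‖ψ(1)‖ ≤ 3εR / R ^ (m+1)`, which is the claimed bound (`norm_solution_sub_le`). The
exponential bound follows by inserting `m = ⌊M⌋ + 1`, where `M = δ / (6eε)`, since then
`6(m-1)ε / δ ≤ 1 / e` and `m ≥ M`.
-/

open Set Metric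
open scoped NNReal Topology

/-! ### Finite differences of a near-identity map -/

section FiniteDifferences

theorem iterate_mem_ball {E : Type*} [NormedAddCommGroup E] {f : E → E} {x : E} {δ ε r : ℝ}
    (hε : ∀ y ∈ ball x δ, ‖f y - y‖ ≤ ε) (h0 : 0 ≤ ε) {y : E} (hy : y ∈ ball x r) (k : ℕ)
    (hk : r + k * ε ≤ δ) : f^[k] y ∈ ball x (r + k * ε) := by
  induction k with
  | zero => simpa using hy
  | succ k ih =>
    push_cast at hk ⊢
    have h1 := ih (by linarith)
    have h2 := hε _ (ball_subset_ball (by linarith) h1)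
    rw [Function.iterate_succ_apply', mem_ball]
    rw [mem_ball] at h1
    calc dist (f (f^[k] y)) x ≤ dist (f (f^[k] y)) (f^[k] y) + dist (f^[k] y) x :=
          dist_triangle _ _ _
      _ < r + (k + 1) * ε := by rw [dist_eq_norm]; linarith

variable {E : Type*} [NormedAddCommGroup E] [NormedSpace ℂ E]

theorem analyticAt_finiteDiff {f : E → E} (k : ℕ) {x : E}
    (h : ∀ j < k, AnalyticAt ℂ f (f^[j] x)) : AnalyticAt ℂ (finiteDiff f k) x := by
  induction k generalizing x with
  | zero => exact analyticAt_id
  | succ k ih =>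
    have h1 : AnalyticAt ℂ (finiteDiff f k) (f x) :=
      ih fun j hj => by simpa using h (j + 1) (by omega)
    have h2 : AnalyticAt ℂ (finiteDiff f k) x := ih fun j hj => h j (by omega)
    exact (h1.comp (by simpa using h 0 (by omega))).sub h2

theorem analyticAt_interpField {f : E → E} (m : ℕ) {x : E}
    (h : ∀ j < m, AnalyticAt ℂ f (f^[j] x)) : AnalyticAt ℂ (interpField f m) x := by
  refine Finset.analyticAt_fun_sum _ fun k hk => ?_
  have hk := Finset.mem_Icc.1 hk
  exact analyticAt_const.smul (analyticAt_finiteDiff k fun j hj => h j (by omega))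

theorem interpField_eq_sum_range (f : E → E) (m : ℕ) (y : E) :
    interpField f m y = ∑ k ∈ Finset.range m,
      ((-1 : ℂ) ^ k / ((k + 1 : ℕ) : ℂ)) • finiteDiff f (k + 1) y := by
  rw [interpField]
  induction m with
  | zero => simp
  | succ m ih => rw [Finset.sum_Icc_succ_top (by omega), ih, Finset.sum_range_succ]; rfl

/-- Each difference costs a layer of width `σ` of the domain and gains a factor `2ε/σ`: by the
Schwarz lemma on the ball of radius `σ` about `y`, `‖Δ_k (f y) - Δ_k y‖` is at most
`(2 sup ‖Δ_k‖ / σ) ‖f y - y‖`. -/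
theorem norm_finiteDiff_succ_le {f : E → E} {x : E} {δ ε σ : ℝ}
    (hf : DifferentiableOn ℂ f (ball x δ))
    (hε : ∀ y ∈ ball x δ, ‖f y - y‖ ≤ ε) (h0 : 0 ≤ ε) (hσ : ε < σ) (k : ℕ) (r : ℝ)
    (hr : r + k * σ ≤ δ) :
    DifferentiableOn ℂ (finiteDiff f (k + 1)) (ball x r) ∧
      ∀ y ∈ ball x r, ‖finiteDiff f (k + 1) y‖ ≤ ε * (2 * ε / σ) ^ k := by
  have hσ0 : 0 < σ := h0.trans_lt hσ
  induction k generalizing r with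
  | zero =>
    have hsub : ball x r ⊆ ball x δ := ball_subset_ball (by simpa using hr)
    exact ⟨(hf.mono hsub).sub differentiableOn_id,
      fun y hy => by simpa [finiteDiff] using hε y (hsub hy)⟩
  | succ k ih =>
    push_cast at hr
    obtain ⟨hd, hb⟩ := ih (r + σ) (by linarith)
    have hsub : ball x r ⊆ ball x δ := ball_subset_ball (by nlinarith [(k.cast_nonneg : (0:ℝ) ≤ k)])
    have hmaps : MapsTo f (ball x r) (ball x (r + σ)) := fun y hy => by
      have := hε y (hsub hy)
      rw [mem_ball] at hy ⊢
      have := dist_triangle (f y) y x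
      rw [dist_eq_norm (f y) y] at this
      linarith
    refine ⟨(hd.comp (hf.mono hsub) hmaps).sub (hd.mono (ball_subset_ball (by linarith))), ?_⟩
    intro y hy
    have hB : ball y σ ⊆ ball x (r + σ) :=
      ball_subset_ball' (by rw [mem_ball] at hy; linarith)
    have hyε := hε y (hsub hy)
    have hfy : f y ∈ ball y σ := by rw [mem_ball, dist_eq_norm]; linarith
    have := Complex.dist_le_div_mul_dist_of_mapsTo_ball (hd.mono hB)
      (R₂ := 2 * (ε * (2 * ε / σ) ^ k)) (fun z hz => by
        rw [mem_closedBall, dist_eq_norm]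
        have h1 := hb z (hB hz)
        have h2 := hb y (hB (mem_ball_self hσ0))
        exact (norm_sub_le _ _).trans (by linarith)) hfy
    rw [dist_eq_norm, dist_eq_norm] at this
    change ‖finiteDiff f (k + 1) (f y) - finiteDiff f (k + 1) y‖ ≤ _
    calc _ ≤ _ := this
      _ ≤ 2 * (ε * (2 * ε / σ) ^ k) / σ * ε := by gcongr
      _ = _ := by rw [pow_succ]; ring

/-- Splitting the layer of width `2δ/3` between the radii `δ/3` and `δ` into `N` equal parts. -/
theorem norm_finiteDiff_succ_le_third {f : E → E} {x : E} {δ ε : ℝ} (hδ : 0 < δ)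
    (hf : DifferentiableOn ℂ f (ball x δ))
    (hε : ∀ y ∈ ball x δ, ‖f y - y‖ ≤ ε) (h0 : 0 ≤ ε) {N k : ℕ} (hN : 1 ≤ N) (hk : k ≤ N)
    (hNε : 6 * N * ε ≤ δ) :
    ∀ y ∈ ball x (δ / 3), ‖finiteDiff f (k + 1) y‖ ≤ ε * (3 * N * ε / δ) ^ k := by
  have hN' : (1 : ℝ) ≤ N := by exact_mod_cast hN
  have hk' : (k : ℝ) ≤ N := by exact_mod_cast hk
  have hσ : ε < 2 * δ / (3 * N) := by rw [lt_div_iff₀ (by positivity)]; nlinarith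
  have := (norm_finiteDiff_succ_le hf hε h0 hσ k (δ / 3) (by
    have : (k : ℝ) * (2 * δ / (3 * N)) ≤ N * (2 * δ / (3 * N)) := by gcongr
    have h2 : (N : ℝ) * (2 * δ / (3 * N)) = 2 * δ / 3 := by field_simp
    linarith)).2
  intro y hy
  convert this y hy using 3
  field_simp

theorem norm_interpField_le {f : E → E} {x : E} {δ ε : ℝ} (hδ : 0 < δ)
    (hf : DifferentiableOn ℂ f (ball x δ))
    (hε : ∀ y ∈ ball x δ, ‖f y - y‖ ≤ ε) (h0 : 0 ≤ ε) {N : ℕ} (hN : 1 ≤ N)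
    (hNε : 6 * N * ε ≤ δ) {m : ℕ} (hm : m ≤ N + 1) :
    ∀ y ∈ ball x (δ / 3), ‖interpField f m y‖ ≤ 2 * ε := by
  intro y hy
  have hq : 3 * N * ε / δ ≤ 1 / 2 := by rw [div_le_iff₀ hδ]; linarith
  have hq0 : 0 ≤ 3 * N * ε / δ := by positivity
  rw [interpField_eq_sum_range]
  calc _ ≤ ∑ k ∈ Finset.range m, ε * (1 / 2) ^ k := by
        refine norm_sum_le_of_le _ fun k hk => ?_
        have hk := Finset.mem_range.1 hk
        rw [norm_smul]
        have h1 : ‖(-1 : ℂ) ^ k / ((k + 1 : ℕ) : ℂ)‖ ≤ 1 := by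
          rw [norm_div, norm_pow, norm_neg, norm_one, one_pow, Complex.norm_natCast]
          rw [div_le_one (by positivity)]
          exact_mod_cast Nat.le_add_left 1 k
        calc _ ≤ 1 * ‖finiteDiff f (k + 1) y‖ := by gcongr
          _ ≤ ε * (3 * N * ε / δ) ^ k := by
            rw [one_mul]
            exact norm_finiteDiff_succ_le_third hδ hf hε h0 hN (by omega) hNε y hy
          _ ≤ _ := by gcongr
    _ = ε * ∑ k ∈ Finset.range m, (1 / 2 : ℝ) ^ k := by rw [Finset.mul_sum]
    _ ≤ 2 * ε := by have := sum_geometric_two_le m; nlinarith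

/-- Cauchy estimate: a bounded holomorphic map is Lipschitz on a smaller ball. -/
theorem lipschitzOnWith_closedBall_of_norm_le {F : Type*} [NormedAddCommGroup F]
    [NormedSpace ℂ F] {X : E → F} {x : E} {a r B : ℝ} (har : a < r)
    (hX : DifferentiableOn ℂ X (ball x r)) (hB : ∀ y ∈ ball x r, ‖X y‖ ≤ B) :
    LipschitzOnWith (Real.toNNReal (2 * B / (r - a))) X (closedBall x a) := by
  let _ := NormedSpace.restrictScalars ℝ ℂ E
  have hra : 0 < r - a := sub_pos.2 har
  refine (convex_closedBall x a).lipschitzOnWith_of_nnnorm_fderiv_le (𝕜 := ℂ) ?_ ?_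
  · exact fun y hy => (hX y (closedBall_subset_ball har hy)).differentiableAt
      (isOpen_ball.mem_nhds (closedBall_subset_ball har hy))
  · intro y hy
    have hsub : ball y (r - a) ⊆ ball x r :=
      ball_subset_ball' (by rw [mem_closedBall] at hy; linarith)
    have := Complex.norm_fderiv_le_div_of_mapsTo_ball (hX.mono hsub) (R₂ := 2 * B)
      (fun z hz => by
        rw [mem_closedBall, dist_eq_norm]
        have h1 := hB z (hsub hz)
        have h2 := hB y (hsub (mem_ball_self hra))
        exact (norm_sub_le _ _).trans (by linarith)) hra
    rw [← NNReal.coe_le_coe, coe_nnnorm]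
    exact this.trans (Real.le_coe_toNNReal _)

end FiniteDifferences

/-! ### The Newton polynomial of an orbit -/

section NewtonSeries

/-- The binomial polynomial `t(t-1)⋯(t-k+1)/k!` as a function of a complex variable. -/
noncomputable def newtonBasis : ℕ → ℂ → ℂ
  | 0, _ => 1
  | k + 1, t => newtonBasis k t * ((t - k) / (k + 1))

theorem differentiable_newtonBasis (k : ℕ) : Differentiable ℂ (newtonBasis k) := by
  induction k with
  | zero => exact differentiable_const _
  | succ k ih => exact ih.mul ((differentiable_id.sub_const _).div_const _)

theorem newtonBasis_succ_add_one (k : ℕ) (t : ℂ) :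
    newtonBasis (k + 1) (t + 1) = newtonBasis (k + 1) t + newtonBasis k t := by
  induction k with
  | zero => simp [newtonBasis]
  | succ k ih =>
    have h1 : (k : ℂ) + 1 ≠ 0 := by exact_mod_cast k.succ_ne_zero
    have h2 : (k : ℂ) + 1 + 1 ≠ 0 := by exact_mod_cast (k + 1).succ_ne_zero
    rw [newtonBasis, ih]
    simp only [newtonBasis]
    push_cast
    field_simp
    ring

theorem newtonBasis_natCast_of_lt {i k : ℕ} (h : i < k) : newtonBasis k i = 0 := by
  induction k with
  | zero => omega
  | succ k ih =>
    rw [newtonBasis]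
    rcases Nat.lt_succ_iff_lt_or_eq.1 h with h | rfl
    · rw [ih h, zero_mul]
    · simp

theorem deriv_newtonBasis_zero (k : ℕ) :
    deriv (newtonBasis (k + 1)) 0 = (-1 : ℂ) ^ k / ((k + 1 : ℕ) : ℂ) := by
  have key (k : ℕ) : deriv (newtonBasis (k + 1)) 0 =
      deriv (newtonBasis k) 0 * ((0 - k) / (k + 1)) + newtonBasis k 0 * (1 / (k + 1)) :=
    ((differentiable_newtonBasis k 0).hasDerivAt.mul
      (((hasDerivAt_id (0 : ℂ)).sub_const (k : ℂ)).div_const ((k : ℂ) + 1))).deriv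
  induction k with
  | zero =>
    rw [key]
    simp [newtonBasis]
  | succ k ih =>
    have h0 : newtonBasis (k + 1) 0 = 0 := by
      simpa using newtonBasis_natCast_of_lt (i := 0) k.succ_pos
    have h1 : (k : ℂ) + 1 ≠ 0 := by exact_mod_cast k.succ_ne_zero
    have h2 : (k : ℂ) + 1 + 1 ≠ 0 := by exact_mod_cast (k + 1).succ_ne_zero
    rw [key, ih, h0]
    push_cast
    field_simp
    ring

theorem norm_newtonBasis_le {T : ℝ} {t : ℂ} {m k : ℕ} (ht : ‖t‖ ≤ T) (hk : k ≤ m) :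
    ‖newtonBasis k t‖ ≤ (T + m) ^ k := by
  have hT : 0 ≤ T := (norm_nonneg t).trans ht
  induction k with
  | zero => simp [newtonBasis]
  | succ k ih =>
    rw [newtonBasis, norm_mul, pow_succ]
    gcongr
    · exact ih (by omega)
    · rw [norm_div]
      have h1 : ‖t - k‖ ≤ T + m := by
        refine (norm_sub_le _ _).trans ?_
        rw [Complex.norm_natCast]
        have : (k : ℝ) ≤ m := by exact_mod_cast (by omega : k ≤ m)
        linarith
      have h2 : (1 : ℝ) ≤ ‖(k : ℂ) + 1‖ := by
        have : ‖((k + 1 : ℕ) : ℂ)‖ = ((k + 1 : ℕ) : ℝ) := Complex.norm_natCast _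
        push_cast at this
        rw [this]
        linarith [(k.cast_nonneg : (0 : ℝ) ≤ k)]
      exact (div_le_self (norm_nonneg _) h2).trans h1

variable {E : Type*} [NormedAddCommGroup E] [NormedSpace ℂ E]

/-- The Newton interpolation polynomial of degree `m` of the orbit of `x`, that is the polynomial
in `t` which passes through `f^[j] x` at the times `t = j` for `j ≤ m`. -/
noncomputable def newtonCurve (f : E → E) (m : ℕ) (x : E) (t : ℂ) : E :=
  ∑ k ∈ Finset.range (m + 1), newtonBasis k t • finiteDiff f k x

theorem differentiable_newtonCurve (f : E → E) (m : ℕ) (x : E) :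
    Differentiable ℂ (newtonCurve f m x) :=
  Differentiable.fun_sum fun k _ => (differentiable_newtonBasis k).smul_const _

/-- The Newton polynomial moved by one unit of time is the Newton polynomial of `f x`, up to a
term of order `m + 1`. -/
theorem newtonCurve_add_one (f : E → E) (m : ℕ) (x : E) (t : ℂ) :
    newtonCurve f m x (t + 1) =
      newtonCurve f m (f x) t - newtonBasis m t • finiteDiff f (m + 1) x := by
  induction m with
  | zero => simp [newtonCurve, newtonBasis, finiteDiff]
  | succ m ih =>
    rw [newtonCurve, Finset.sum_range_succ, ← newtonCurve, ih, newtonCurve, newtonCurve,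
      Finset.sum_range_succ _ (m + 1), newtonBasis_succ_add_one]
    simp only [finiteDiff, add_smul, smul_sub]
    abel

theorem newtonCurve_natCast (f : E → E) (m : ℕ) {j : ℕ} (hj : j ≤ m) (x : E) :
    newtonCurve f m x j = f^[j] x := by
  induction j generalizing x with
  | zero =>
    rw [newtonCurve, Finset.sum_range_succ', Finset.sum_eq_zero]
    · simp [newtonBasis, finiteDiff]
    · intro k _
      rw [newtonBasis_natCast_of_lt k.succ_pos, zero_smul]
  | succ j ih =>
    rw [Nat.cast_succ, newtonCurve_add_one, ih (by omega), newtonBasis_natCast_of_lt (by omega)]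
    simp

/-- The interpolating vector field is the initial velocity of the Newton polynomial. -/
theorem deriv_newtonCurve_zero (f : E → E) (m : ℕ) (x : E) :
    deriv (newtonCurve f m x) 0 = interpField f m x := by
  have h : HasDerivAt (newtonCurve f m x)
      (∑ k ∈ Finset.range (m + 1), deriv (newtonBasis k) 0 • finiteDiff f k x) 0 :=
    HasDerivAt.fun_sum fun k _ => (differentiable_newtonBasis k 0).hasDerivAt.smul_const _
  have h0 : deriv (newtonBasis 0) 0 = 0 := (hasDerivAt_const (0 : ℂ) (1 : ℂ)).deriv
  rw [h.deriv, interpField_eq_sum_range, Finset.sum_range_succ', h0, zero_smul, add_zero]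
  simp only [deriv_newtonBasis_zero]

theorem deriv_newtonCurve_natCast (f : E → E) (m j : ℕ) (x : E) :
    deriv (newtonCurve f m x) j = interpField f m (f^[j] x) -
      ∑ i ∈ Finset.range j,
        deriv (newtonBasis m) ((j - (i + 1) : ℕ) : ℂ) • finiteDiff f (m + 1) (f^[i] x) := by
  induction j generalizing x with
  | zero => simp [deriv_newtonCurve_zero]
  | succ j ih =>
    have h1 : deriv (newtonCurve f m x) ((j + 1 : ℕ) : ℂ) =
        deriv (fun t => newtonCurve f m x (t + 1)) j := by
      rw [deriv_comp_add_const, Nat.cast_succ]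
    have h2 : (fun t => newtonCurve f m x (t + 1)) = fun t =>
        newtonCurve f m (f x) t - newtonBasis m t • finiteDiff f (m + 1) x :=
      funext fun t => newtonCurve_add_one f m x t
    have h3 : HasDerivAt (fun t =>
        newtonCurve f m (f x) t - newtonBasis m t • finiteDiff f (m + 1) x)
        (deriv (newtonCurve f m (f x)) j - deriv (newtonBasis m) j • finiteDiff f (m + 1) x) j :=
      (differentiable_newtonCurve f m (f x) j).hasDerivAt.sub
        ((differentiable_newtonBasis m j).hasDerivAt.smul_const _)
    rw [h1, h2, h3.deriv, ih, Finset.sum_range_succ', sub_sub]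
    simp only [Function.iterate_succ_apply, Function.iterate_zero_apply,
      Nat.add_sub_add_right, Nat.sub_zero]

end NewtonSeries

/-! ### Interpolation at equidistant nodes -/

section Interpolation

variable {E : Type*} [NormedAddCommGroup E] [NormedSpace ℂ E] [CompleteSpace E]

/-- A holomorphic function which is bounded by `C` on a disc of radius more than `N + τ` and by
`e` at the `N` equidistant nodes `c, c + 1, …` is of size `O(e + C / τ ^ N)` at bounded distance
from the nodes. This is Newton's interpolation formula with remainder: the divided differences
are iterated `dslope`s, each bounded by the Schwarz lemma. -/
theorem exists_norm_le_of_norm_le_at_nodes (N : ℕ) {M : ℝ} (hM : 0 ≤ M) :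
    ∃ A : ℝ, 0 ≤ A ∧ ∀ (h : ℂ → E) (c z : ℂ) (T τ C e : ℝ), 0 < τ → N + τ ≤ T →
      DifferentiableOn ℂ h (ball c T) → (∀ w ∈ ball c T, ‖h w‖ ≤ C) →
      (∀ i < N, ‖h (c + i)‖ ≤ e) →
      (∀ i ≤ N, ‖z - (c + i)‖ ≤ M ∧ ‖z - (c + i)‖ < τ) →
      0 ≤ e → ‖h z‖ ≤ A * (e + C / τ ^ N) := by
  induction N with
  | zero =>
    refine ⟨1, zero_le_one, fun h c z T τ C e _ hT _ hC _ hz he => ?_⟩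
    have := hC z (by
      have := (hz 0 le_rfl).2
      rw [mem_ball, dist_eq_norm]
      simp at this hT
      linarith)
    simp
    linarith
  | succ N ih =>
    obtain ⟨A, hA, ih⟩ := ih
    refine ⟨1 + M * (A * 2), by positivity, fun h c z T τ C e hτ hT hd hC hn hz he => ?_⟩
    push_cast at hT
    have hN : (0 : ℝ) ≤ N := N.cast_nonneg
    have hT0 : 0 < T := by linarith
    have hc : ball c T ∈ nhds c := ball_mem_nhds c hT0
    have hC0 : 0 ≤ C := (norm_nonneg _).trans (hC c (mem_ball_self hT0))
    have hsub : ball (c + 1) (T - 1) ⊆ ball c T := ball_subset_ball' (by simp [dist_eq_norm])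
    have hd' : DifferentiableOn ℂ (dslope h c) (ball c T) :=
      (Complex.differentiableOn_dslope hc).2 hd
    have hhc : ‖h c‖ ≤ e := by simpa using hn 0 N.succ_pos
    have hslope : ∀ w ∈ ball c T, ‖dslope h c w‖ ≤ 2 * C / τ := by
      intro w hw
      refine (Complex.norm_dslope_le_div_of_mapsTo_ball hd (R₂ := 2 * C) (fun v hv => ?_) hw).trans
        ?_
      · rw [mem_closedBall, dist_eq_norm]
        exact (norm_sub_le _ _).trans (by linarith [hC v hv, hC c (mem_ball_self hT0)])
      · gcongr
        linarith
    have hnodes : ∀ i < N, ‖dslope h c (c + 1 + i)‖ ≤ 2 * e := by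
      intro i hi
      have hne : (c + 1 + i : ℂ) - c = ((i + 1 : ℕ) : ℂ) := by push_cast; ring
      have hne' : (c + 1 + i : ℂ) ≠ c := fun h0 => by
        rw [h0, sub_self] at hne
        exact i.succ_ne_zero (by exact_mod_cast hne.symm)
      have h1 : ‖h (c + 1 + i)‖ ≤ e := by
        have := hn (i + 1) (by omega)
        push_cast at this
        rwa [show (c + 1 + i : ℂ) = c + (i + 1) by ring]
      rw [dslope_of_ne _ hne', slope_def_module, norm_smul, norm_inv, hne, Complex.norm_natCast]
      have h2 : ((i + 1 : ℕ) : ℝ)⁻¹ ≤ 1 := inv_le_one_of_one_le₀ (by simp)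
      calc _ ≤ 1 * (‖h (c + 1 + i)‖ + ‖h c‖) := by gcongr; exact norm_sub_le _ _
        _ ≤ 2 * e := by linarith
    have hz0 : ‖z - c‖ ≤ M := by simpa using (hz 0 (by omega)).1
    have key := ih (dslope h c) (c + 1) z (T - 1) τ (2 * C / τ) (2 * e) hτ (by linarith)
      (hd'.mono hsub) (fun w hw => hslope w (hsub hw)) hnodes (fun i hi => by
        have := hz (i + 1) (by omega)
        push_cast at this
        rwa [show (c + 1 + i : ℂ) = c + (i + 1) by ring]) (by positivity)
    have hz' : h z = h c + (z - c) • dslope h c z := by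
      rw [sub_smul_dslope]; abel
    rw [hz']
    calc _ ≤ ‖h c‖ + ‖z - c‖ * ‖dslope h c z‖ := by
          rw [← norm_smul]; exact norm_add_le _ _
      _ ≤ e + M * (A * (2 * e + 2 * C / τ / τ ^ N)) := by gcongr
      _ = e + M * (A * 2) * (e + C / τ ^ (N + 1)) := by
          rw [pow_succ', div_div]; ring
      _ ≤ (1 + M * (A * 2)) * (e + C / τ ^ (N + 1)) := by
          have : 0 ≤ C / τ ^ (N + 1) := by positivity
          linarith

end Interpolation

/-! ### Solutions of ordinary differential equations -/

section Solutions

variable {E : Type*} [NormedAddCommGroup E] [NormedSpace ℝ E]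

theorem IsSolution.continuousOn {X : E → E} {U : Set E} {T : ℝ} {x : E} {γ : ℝ → E}
    (h : IsSolution X U T x γ) : ContinuousOn γ (Icc 0 T) :=
  fun t ht => (h.2 t ht).2.continuousWithinAt

theorem IsSolution.hasDerivWithinAt_Ici {X : E → E} {U : Set E} {T : ℝ} {x : E} {γ : ℝ → E}
    (h : IsSolution X U T x γ) {t : ℝ} (ht : t ∈ Ico 0 T) :
    HasDerivWithinAt γ (X (γ t)) (Ici t) t :=
  ((h.2 t ⟨ht.1, ht.2.le⟩).2.mono (Icc_subset_Icc_left ht.1)).mono_of_mem_nhdsWithin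
    (Icc_mem_nhdsGE ht.2)

theorem IsSolution.norm_sub_le {X : E → E} {U : Set E} {T : ℝ} {x : E} {γ : ℝ → E} {K : ℝ}
    (h : IsSolution X U T x γ) (hK : ∀ y ∈ U, ‖X y‖ ≤ K) {t : ℝ} (ht : t ∈ Icc 0 T) :
    ‖γ t - x‖ ≤ K * t := by
  have := (convex_Icc 0 T).norm_image_sub_le_of_norm_hasDerivWithin_le
    (fun s hs => (h.2 s hs).2) (fun s hs => hK _ (h.2 s hs).1)
    (left_mem_Icc.2 (ht.1.trans ht.2)) ht
  rwa [h.1, sub_zero, Real.norm_of_nonneg ht.1] at this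

/-- The Picard-Lindelöf theorem, with the additional information that the solution stays in the
ball. This is read off from the fixed point in `ODE.FunSpace`, whose elements take their values in
`closedBall x K`. -/
theorem exists_isSolution_ball [CompleteSpace E] {X : E → E} {x : E} {r K : ℝ} {L : ℝ≥0}
    (hK0 : 0 ≤ K) (hKr : K < r) (hK : ∀ y ∈ ball x r, ‖X y‖ ≤ K)
    (hL : LipschitzOnWith L X (closedBall x K)) : ∃ γ, IsSolution X (ball x r) 1 x γ := by
  lift K to ℝ≥0 using hK0
  have hsub := closedBall_subset_ball (x := x) hKr
  have hP : IsPicardLindelof (fun _ => X) (⟨0, by simp⟩ : Icc (0 : ℝ) 1) x K 0 K L :=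
    { lipschitzOnWith := fun _ _ => hL
      continuousOn := fun _ _ => continuousOn_const
      norm_le := fun _ _ y hy => hK y (hsub hy)
      mul_max_le := by simp }
  have hx : x ∈ closedBall x ((0 : ℝ≥0) : ℝ) := mem_closedBall_self le_rfl
  obtain ⟨α, hα⟩ := ODE.FunSpace.exists_isFixedPt_next hP hx
  have hmem (t : ℝ) : α.compProj t ∈ closedBall x K := α.compProj_mem_closedBall hP.mul_max_le
  have hpic : ∀ t ∈ Icc (0 : ℝ) 1, α.compProj t = ODE.picard (fun _ => X) 0 x α.compProj t := by
    intro t ht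
    nth_rw 1 [← hα]
    rw [ODE.FunSpace.compProj_apply, ODE.FunSpace.next_apply, projIcc_of_mem _ ht]
  refine ⟨α.compProj, ?_, fun t ht => ⟨hsub (hmem t), ?_⟩⟩
  · rw [hpic 0 (by simp), ODE.picard_apply₀]
  · have := ODE.hasDerivWithinAt_picard_Icc (f := fun _ => X) (u := closedBall x K)
      (t₀ := (0 : ℝ)) (tmin := 0) (tmax := 1) (by simp)
      (hL.continuousOn.comp continuousOn_snd fun p hp => hp.2)
      α.continuous_compProj.continuousOn (fun t _ => hmem t) x ht
    exact this.congr_of_mem (fun s hs => hpic s hs) ht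

theorem IsSolution.eqOn {X : E → E} {U : Set E} {T T' : ℝ} {x : E} {γ γ' : ℝ → E} {K : ℝ}
    {L : ℝ≥0} (hK0 : 0 ≤ K) (hK : ∀ y ∈ U, ‖X y‖ ≤ K) (hL : LipschitzOnWith L X (closedBall x K))
    (h : IsSolution X U T x γ) (h' : IsSolution X U T' x γ') (hT' : T' ≤ T) (hT : T ≤ 1) :
    EqOn γ' γ (Icc 0 T') := by
  have hmem {S : ℝ} {β : ℝ → E} (hβ : IsSolution X U S x β) (hS : S ≤ 1) {t : ℝ}
      (ht : t ∈ Icc 0 S) : β t ∈ closedBall x K := by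
    rw [mem_closedBall, dist_eq_norm]
    exact (hβ.norm_sub_le hK ht).trans (mul_le_of_le_one_right hK0 (ht.2.trans hS))
  exact ODE_solution_unique_of_mem_Icc_right (v := fun _ => X) (s := fun _ => closedBall x K)
    (fun _ _ => hL) h'.continuousOn (fun t ht => h'.hasDerivWithinAt_Ici ht)
    (fun t ht => hmem h' (hT'.trans hT) ⟨ht.1, ht.2.le⟩)
    (h.continuousOn.mono (Icc_subset_Icc_right hT'))
    (fun t ht => h.hasDerivWithinAt_Ici ⟨ht.1, ht.2.trans_le hT'⟩)
    (fun t ht => hmem h hT ⟨ht.1, ht.2.le.trans hT'⟩) (h'.1.trans h.1.symm)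

end Solutions

section Euler

variable {E : Type*} [NormedAddCommGroup E] [NormedSpace ℂ E]

/-- The `j`-th vertex of the Euler polygon of step `h` for the vector field `X`, started at `x`. The
step is complex so that only the complex structure of `E` enters. -/
noncomputable def eulerPoint (X : E → E) (h : ℂ) (x : E) : ℕ → E
  | 0 => x
  | j + 1 => eulerPoint X h x j + h • X (eulerPoint X h x j)

theorem norm_eulerPoint_sub_le {X : E → E} {x : E} {r K : ℝ} {N : ℕ} (hN : 0 < N) (hK0 : 0 ≤ K)
    (hKr : K < r) (hK : ∀ y ∈ ball x r, ‖X y‖ ≤ K) {j : ℕ} (hj : j ≤ N) :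
    ‖eulerPoint X (1 / N) x j - x‖ ≤ K * (j / N) := by
  induction j with
  | zero => simp [eulerPoint]
  | succ j ih =>
    have hN' : (0 : ℝ) < N := by exact_mod_cast hN
    have hj' : (j : ℝ) ≤ N := by exact_mod_cast (by omega : j ≤ N)
    have h1 := ih (by omega)
    have hmem : eulerPoint X (1 / N) x j ∈ ball x r := by
      rw [mem_ball, dist_eq_norm]
      have : (j : ℝ) / N ≤ 1 := by rw [div_le_one hN']; exact hj'
      nlinarith
    have h2 := hK _ hmem
    rw [eulerPoint, add_sub_right_comm]
    have h3 : ‖(1 / N : ℂ)‖ = 1 / N := by simp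
    calc _ ≤ _ := norm_add_le _ _
      _ ≤ K * (j / N) + 1 / N * K := by rw [norm_smul, h3]; gcongr
      _ = K * ((j + 1 : ℕ) / N) := by push_cast; ring

variable [NormedSpace ℝ E] [IsScalarTower ℝ ℂ E]

/-- Convergence of Euler's method, with an error bound that depends only on the bound `K` and the
Lipschitz constant `L` of the vector field. -/
theorem IsSolution.norm_sub_eulerPoint_le {X : E → E} {x : E} {r K : ℝ} {L : ℝ≥0} {γ : ℝ → E}
    (hγ : IsSolution X (ball x r) 1 x γ) {N : ℕ} (hN : 0 < N) (hK0 : 0 ≤ K)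
    (hKr : K < r) (hK : ∀ y ∈ ball x r, ‖X y‖ ≤ K) (hL : LipschitzOnWith L X (closedBall x K)) :
    ‖γ 1 - eulerPoint X (1 / N) x N‖ ≤ Real.exp L * (L * K) / N := by
  have hN' : (0 : ℝ) < N := by exact_mod_cast hN
  have hγK : ∀ t ∈ Icc (0 : ℝ) 1, γ t ∈ closedBall x K := fun t ht => by
    rw [mem_closedBall, dist_eq_norm]
    exact (hγ.norm_sub_le hK ht).trans (mul_le_of_le_one_right hK0 ht.2)
  have hsmul (v : E) : ((1 / N : ℝ)) • v = (1 / N : ℂ) • v := by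
    rw [← algebraMap_smul ℂ (1 / N : ℝ) v]; simp
  have hstep : ∀ j < N, ‖γ ((j + 1 : ℕ) / N) - γ (j / N) - (1 / N : ℂ) • X (γ (j / N))‖ ≤
      L * K / N ^ 2 := by
    intro j hj
    have hj1 : ((j + 1 : ℕ) : ℝ) ≤ N := by exact_mod_cast hj
    have hle : (j : ℝ) / N ≤ (j + 1 : ℕ) / N := by gcongr; simp
    have h0 : (0 : ℝ) ≤ j / N := by positivity
    have h1 : ((j + 1 : ℕ) : ℝ) / N ≤ 1 := by rw [div_le_one hN']; exact hj1
    have hsub : Icc ((j : ℝ) / N) ((j + 1 : ℕ) / N) ⊆ Icc 0 1 := Icc_subset_Icc h0 h1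
    have hwid : ((j + 1 : ℕ) : ℝ) / N - j / N = 1 / N := by push_cast; ring
    have hjm : (j : ℝ) / N ∈ Icc (0 : ℝ) 1 := hsub (left_mem_Icc.2 hle)
    have hvar : ∀ s ∈ Icc ((j : ℝ) / N) ((j + 1 : ℕ) / N),
        ‖γ s - γ (j / N)‖ ≤ K * (1 / N) := by
      intro s hs
      have := (convex_Icc (0 : ℝ) 1).norm_image_sub_le_of_norm_hasDerivWithin_le
        (fun u hu => (hγ.2 u hu).2) (fun u hu => hK _ (hγ.2 u hu).1) hjm (hsub hs)
      refine this.trans ?_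
      rw [Real.norm_of_nonneg (by linarith [hs.1])]
      gcongr
      linarith [hs.2]
    have := (convex_Icc ((j : ℝ) / N) ((j + 1 : ℕ) / N)).norm_image_sub_le_of_norm_hasDerivWithin_le
      (f := fun s => γ s - s • X (γ (j / N))) (f' := fun s => X (γ s) - X (γ (j / N)))
      (C := L * (K * (1 / N)))
      (fun s hs => by
        simpa using ((hγ.2 s (hsub hs)).2.mono hsub).fun_sub
          ((hasDerivWithinAt_id s _).smul_const (X (γ (j / N)))))
      (fun s hs => by
        have := hL.dist_le_mul _ (hγK s (hsub hs)) _ (hγK _ hjm)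
        rw [dist_eq_norm, dist_eq_norm] at this
        exact this.trans (by gcongr; exact hvar s hs))
      (left_mem_Icc.2 hle) (right_mem_Icc.2 hle)
    rw [hwid, Real.norm_of_nonneg (by positivity)] at this
    rw [← hsmul, ← hwid, sub_smul]
    convert this using 1
    · congr 1; abel
    · field_simp
  have hmain : ∀ j ≤ N, ‖γ (j / N) - eulerPoint X (1 / N) x j‖ ≤
      Real.exp (L / N) ^ j * (j * (L * K / N ^ 2)) := by
    intro j
    induction j with
    | zero => intro _; simp [eulerPoint, hγ.1]
    | succ j ih =>
      intro hj
      have hj' : (j : ℝ) ≤ N := by exact_mod_cast (by omega : j ≤ N)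
      have h1 := ih (by omega)
      have h2 := hstep j (by omega)
      have hjm : (j : ℝ) / N ∈ Icc (0 : ℝ) 1 := ⟨by positivity, by rw [div_le_one hN']; exact hj'⟩
      have hmem : eulerPoint X (1 / N) x j ∈ closedBall x K := by
        rw [mem_closedBall, dist_eq_norm]
        exact (norm_eulerPoint_sub_le hN hK0 hKr hK (by omega : j ≤ N)).trans
          (mul_le_of_le_one_right hK0 hjm.2)
      have h3 := hL.dist_le_mul _ (hγK _ hjm) _ hmem
      rw [dist_eq_norm, dist_eq_norm] at h3
      set a := ‖γ (j / N) - eulerPoint X (1 / N) x j‖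
      have hexp : 1 + (L : ℝ) / N ≤ Real.exp (L / N) := by
        rw [add_comm]; exact Real.add_one_le_exp _
      have hexp1 : 1 ≤ Real.exp (L / N) := Real.one_le_exp (by positivity)
      have hn : ‖(1 / N : ℂ)‖ = 1 / N := by simp
      have hsplit : γ ((j + 1 : ℕ) / N) - eulerPoint X (1 / N) x (j + 1) =
          (γ ((j + 1 : ℕ) / N) - γ (j / N) - (1 / N : ℂ) • X (γ (j / N))) +
          ((γ (j / N) - eulerPoint X (1 / N) x j) +
            (1 / N : ℂ) • (X (γ (j / N)) - X (eulerPoint X (1 / N) x j))) := by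
        rw [eulerPoint, smul_sub]; abel
      have hc : 0 ≤ L * K / N ^ 2 := by positivity
      calc _ ≤ L * K / N ^ 2 + (a + 1 / N * (L * a)) := by
            rw [hsplit]
            refine (norm_add_le _ _).trans (add_le_add h2 ((norm_add_le _ _).trans ?_))
            rw [norm_smul, hn]
            gcongr
        _ = L * K / N ^ 2 + (1 + L / N) * a := by ring
        _ ≤ Real.exp (L / N) ^ (j + 1) * (L * K / N ^ 2) +
            Real.exp (L / N) * (Real.exp (L / N) ^ j * (j * (L * K / N ^ 2))) := by
            gcongr
            exact le_mul_of_one_le_left hc (one_le_pow₀ hexp1)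
        _ = _ := by push_cast; ring
  have := hmain N le_rfl
  rw [div_self hN'.ne', ← Real.exp_nat_mul, mul_div_cancel₀ _ hN'.ne'] at this
  refine this.trans_eq ?_
  field_simp

/-- The time-one map of a holomorphic family of vector fields depends holomorphically on the
parameter: it is the uniform limit of the Euler polygons, which do so by composition. -/
theorem differentiableOn_solution_one [CompleteSpace E] {Y : ℂ → E → E} {x : E} {R r K : ℝ}
    {γ : ℂ → ℝ → E} (hK0 : 0 ≤ K) (hKr : K < r)
    (hY : DifferentiableOn ℂ (fun p : ℂ × E => Y p.1 p.2) (ball 0 R ×ˢ ball x r))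
    (hK : ∀ μ ∈ ball (0 : ℂ) R, ∀ y ∈ ball x r, ‖Y μ y‖ ≤ K)
    (hγ : ∀ μ ∈ ball (0 : ℂ) R, IsSolution (Y μ) (ball x r) 1 x (γ μ)) :
    DifferentiableOn ℂ (fun μ => γ μ 1) (ball 0 R) := by
  set L : ℝ≥0 := Real.toNNReal (2 * K / (r - K))
  have hL : ∀ μ ∈ ball (0 : ℂ) R, LipschitzOnWith L (Y μ) (closedBall x K) := fun μ hμ =>
    lipschitzOnWith_closedBall_of_norm_le hKr
      (hY.comp (f := fun y => (μ, y)) (by fun_prop) fun y hy => ⟨hμ, hy⟩) (hK μ hμ)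
  have hmem (N j : ℕ) (hj : j ≤ N + 1) : ∀ μ ∈ ball (0 : ℂ) R,
      eulerPoint (Y μ) (1 / (N + 1 : ℕ)) x j ∈ ball x r := fun μ hμ => by
    have h1 := norm_eulerPoint_sub_le N.succ_pos hK0 hKr (hK μ hμ) hj
    rw [mem_ball, dist_eq_norm]
    have h2 : (j : ℝ) / (N + 1 : ℕ) ≤ 1 := by
      rw [div_le_one (by positivity)]; exact_mod_cast hj
    nlinarith
  have hd (N j : ℕ) (hj : j ≤ N + 1) : DifferentiableOn ℂ
      (fun μ => eulerPoint (Y μ) (1 / (N + 1 : ℕ)) x j) (ball 0 R) := by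
    induction j with
    | zero => exact differentiableOn_const _
    | succ j ih =>
      have h1 := ih (by omega)
      exact h1.add ((hY.comp (differentiableOn_id.prodMk h1)
        fun μ hμ => ⟨hμ, hmem N j (by omega) μ hμ⟩).const_smul _)
  have hlim : TendstoUniformlyOn
      (fun (N : ℕ) μ => eulerPoint (Y μ) (1 / (N + 1 : ℕ)) x (N + 1)) (fun μ => γ μ 1)
      Filter.atTop (ball 0 R) := by
    rw [Metric.tendstoUniformlyOn_iff]
    intro η hη
    have h0 : Filter.Tendsto (fun N : ℕ => Real.exp L * (L * K) / ((N + 1 : ℕ) : ℝ))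
        Filter.atTop (𝓝 0) :=
      (tendsto_const_div_atTop_nhds_zero_nat _).comp (Filter.tendsto_add_atTop_nat 1)
    filter_upwards [h0.eventually (gt_mem_nhds hη)] with N hN μ hμ
    rw [dist_eq_norm]
    exact ((hγ μ hμ).norm_sub_eulerPoint_le N.succ_pos hK0 hKr (hK μ hμ) (hL μ hμ)).trans_lt hN
  exact hlim.tendstoLocallyUniformlyOn.differentiableOn
    (Filter.Eventually.of_forall fun N => hd N (N + 1) le_rfl) isOpen_ball

end Euler

/-! ### Order of contact of the time-one map -/

section OrderOfContact

variable {E : Type*} [NormedAddCommGroup E] [NormedSpace ℂ E]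

/-- On a disc of radius comparable to `δ/ε` the Newton polynomial stays close to `x`. -/
theorem norm_newtonCurve_sub_le {f : E → E} {x : E} {δ ε : ℝ} (hδ : 0 < δ)
    (hf : DifferentiableOn ℂ f (ball x δ)) (hε : ∀ y ∈ ball x δ, ‖f y - y‖ ≤ ε) (h0 : 0 ≤ ε)
    {m : ℕ} (hm : 1 ≤ m) {t : ℂ} {S : ℝ} (ht : ‖t‖ ≤ S) (hS : 6 * m * ε * (S + m) ≤ δ) :
    ‖newtonCurve f m x t - x‖ ≤ δ / 6 := by
  have hm' : (1 : ℝ) ≤ m := by exact_mod_cast hm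
  have hS0 : 0 ≤ S := (norm_nonneg t).trans ht
  have hmε : 6 * m * ε ≤ δ := by
    refine le_trans ?_ hS
    exact le_mul_of_one_le_right (by positivity) (by linarith)
  have hx : x ∈ ball x (δ / 3) := mem_ball_self (by positivity)
  have hsum : newtonCurve f m x t - x =
      ∑ k ∈ Finset.range m, newtonBasis (k + 1) t • finiteDiff f (k + 1) x := by
    rw [newtonCurve, Finset.sum_range_succ']
    simp [newtonBasis, finiteDiff]
  have hterm : ∀ k ∈ Finset.range m,
      ‖newtonBasis (k + 1) t • finiteDiff f (k + 1) x‖ ≤ δ / (6 * m) := by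
    intro k hk
    have hk := Finset.mem_range.1 hk
    have h1 := norm_newtonBasis_le ht (by omega : k + 1 ≤ m)
    have h2 := norm_finiteDiff_succ_le_third hδ hf hε h0 hm hk.le hmε x hx
    have h3 : (S + m) * (3 * m * ε / δ) ≤ 1 := by
      rw [mul_div_assoc', div_le_one hδ]
      nlinarith [show 0 ≤ 3 * m * ε * (S + m) by positivity]
    rw [norm_smul]
    calc _ ≤ (S + m) ^ (k + 1) * (ε * (3 * m * ε / δ) ^ k) := by gcongr
      _ = (S + m) * ε * ((S + m) * (3 * m * ε / δ)) ^ k := by rw [mul_pow, pow_succ]; ring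
      _ ≤ (S + m) * ε * 1 := by
        gcongr
        exact pow_le_one₀ (by positivity) h3
      _ ≤ δ / (6 * m) := by
        rw [le_div_iff₀ (by positivity)]
        linarith
  rw [hsum]
  refine (norm_sum_le_of_le _ hterm).trans_eq ?_
  rw [Finset.sum_const, Finset.card_range, nsmul_eq_mul]
  field_simp

variable [CompleteSpace E] [NormedSpace ℝ E] [IsScalarTower ℝ ℂ E]

/-- The time-one map of the interpolating vector field agrees with `f` up to `O(ε ^ (m + 1))`.

The Newton polynomial `P` of the orbit of `x` passes through `f x` at time one, and its defect
`P' - X_m(P)` is bounded on a disc of radius comparable to `1/ε` and of size `O(ε ^ (m + 1))` at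
the nodes `0, …, m`. By interpolation the defect is `O(ε ^ (m + 1))` on `[0, 1]`, and Gronwall's
inequality compares `P` with the solution. -/
theorem exists_norm_solution_sub_le {m : ℕ} (hm : 1 ≤ m) {δ : ℝ} (hδ : 0 < δ) :
    ∃ C c : ℝ, 0 < c ∧ ∀ (f : E → E) (x : E) (ε : ℝ) (γ : ℝ → E), 0 < ε → ε ≤ c →
      DifferentiableOn ℂ f (ball x δ) → (∀ y ∈ ball x δ, ‖f y - y‖ ≤ ε) →
      DifferentiableOn ℂ (interpField f m) (ball x (δ / 3)) →
      IsSolution (interpField f m) (ball x (δ / 3)) 1 x γ →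
      ‖γ 1 - f x‖ ≤ C * ε ^ (m + 1) := by
  obtain ⟨A, hA, hinterp⟩ := exists_norm_le_of_norm_le_at_nodes (E := E) (m + 1)
    (M := m + 1) (by positivity)
  have hm' : (1 : ℝ) ≤ m := by exact_mod_cast hm
  set b : ℝ := ∑ j ∈ Finset.range (m + 1), ∑ i ∈ Finset.range j,
    ‖deriv (newtonBasis m) ((j - (i + 1) : ℕ) : ℂ)‖ with hb
  have hb0 : 0 ≤ b := Finset.sum_nonneg fun _ _ => Finset.sum_nonneg fun _ _ => norm_nonneg _
  refine ⟨A * (b * (3 * m / δ) ^ m + δ / (δ / (12 * m)) ^ (m + 1)) * (Real.exp 1 - 1),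
    δ / (12 * m * (2 * m + 2)), by positivity, ?_⟩
  intro f x ε γ hε0 hεc hf hε hX hγ
  have hεc' : ε * (12 * m * (2 * m + 2)) ≤ δ := (le_div_iff₀ (by positivity)).1 hεc
  have hε48 : 48 * ε ≤ δ := by nlinarith [mul_le_mul hm' hm' zero_le_one (by positivity)]
  have hmε : 6 * m * ε ≤ δ := by nlinarith [mul_le_mul hm' hm' zero_le_one (by positivity)]
  -- the radius of the disc on which the defect is bounded is twice `τ`, up to `O(1)`
  set τ : ℝ := δ / (12 * m * ε) with hτ
  have hτm : 2 * m + 2 ≤ τ := by rw [hτ, le_div_iff₀ (by positivity)]; linarith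
  have hτ2 : 6 * m * ε * (2 * τ) = δ := by rw [hτ]; field_simp; norm_num
  set P := newtonCurve f m x with hP
  have hPd : Differentiable ℂ P := differentiable_newtonCurve f m x
  have hPx : ∀ t : ℂ, ‖t‖ ≤ 2 * τ - m → ‖P t - x‖ ≤ δ / 6 := fun t ht =>
    norm_newtonCurve_sub_le hδ hf hε hε0.le hm ht (by rw [sub_add_cancel, hτ2])
  have hsub : closedBall x (δ / 6) ⊆ ball x (δ / 3) := closedBall_subset_ball (by linarith)
  have hPmem : ∀ t : ℂ, ‖t‖ ≤ 2 * τ - m → P t ∈ closedBall x (δ / 6) := fun t ht => by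
    rw [mem_closedBall, dist_eq_norm]; exact hPx t ht
  have hXε := norm_interpField_le hδ hf hε hε0.le hm hmε (by omega : m ≤ m + 1)
  have hderiv : ∀ t : ℂ, ‖t‖ ≤ 2 * τ - m - 1 → ‖deriv P t‖ ≤ δ / 6 := by
    intro t ht
    have h1 := Complex.norm_deriv_le_of_forall_mem_sphere_norm_le (f := fun s => P s - x)
      (c := t) (R := 1) (C := δ / 6) one_pos (hPd.sub_const x).diffContOnCl fun z hz => by
        refine hPx z ?_
        rw [mem_sphere, dist_eq_norm] at hz
        have := norm_add_le (z - t) t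
        rw [sub_add_cancel] at this
        linarith
    rwa [deriv_sub_const, div_one] at h1
  have hX2 : DifferentiableOn ℂ (fun t => deriv P t - interpField f m (P t))
      (ball 0 (2 * τ - m - 1)) := by
    refine hPd.differentiableOn.deriv isOpen_ball |>.sub (hX.comp hPd.differentiableOn ?_)
    intro t ht
    rw [mem_ball_zero_iff] at ht
    exact hsub (hPmem t (by linarith))
  have hbound : ∀ t ∈ ball (0 : ℂ) (2 * τ - m - 1),
      ‖deriv P t - interpField f m (P t)‖ ≤ δ := by
    intro t ht
    rw [mem_ball_zero_iff] at ht
    have h1 := hderiv t ht.le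
    have h2 := hXε (P t) (hsub (hPmem t (by linarith)))
    exact (norm_sub_le _ _).trans (by linarith)
  have hnodes : ∀ j < m + 1, ‖deriv P (0 + (j : ℂ)) - interpField f m (P (0 + (j : ℂ)))‖ ≤
      b * (ε * (3 * m * ε / δ) ^ m) := by
    intro j hj
    -- here `P j = f^[j] x`, and the defect is a combination of the `Δ_{m+1}` along the orbit
    rw [zero_add, hP, newtonCurve_natCast f m (by omega), deriv_newtonCurve_natCast,
      sub_sub_cancel_left, norm_neg]
    calc _ ≤ ∑ i ∈ Finset.range j, ‖deriv (newtonBasis m) ((j - (i + 1) : ℕ) : ℂ)‖ *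
          (ε * (3 * m * ε / δ) ^ m) := by
          refine norm_sum_le_of_le _ fun i hi => ?_
          have hi := Finset.mem_range.1 hi
          rw [norm_smul]
          gcongr
          refine norm_finiteDiff_succ_le_third hδ hf hε hε0.le hm le_rfl hmε _ ?_
          have hi' : (i : ℝ) ≤ m := by exact_mod_cast (by omega : i ≤ m)
          have hiε : (i : ℝ) * ε ≤ m * ε := by gcongr
          exact ball_subset_ball (by linarith) (iterate_mem_ball hε hε0.le
            (mem_ball_self (by positivity : 0 < δ / 6)) i (by linarith))
      _ = (∑ i ∈ Finset.range j, ‖deriv (newtonBasis m) ((j - (i + 1) : ℕ) : ℂ)‖) *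
          (ε * (3 * m * ε / δ) ^ m) := by rw [Finset.sum_mul]
      _ ≤ _ := by
          gcongr
          exact Finset.single_le_sum (f := fun j => ∑ i ∈ Finset.range j,
            ‖deriv (newtonBasis m) ((j - (i + 1) : ℕ) : ℂ)‖)
            (fun _ _ => Finset.sum_nonneg fun _ _ => norm_nonneg _) (Finset.mem_range.2 hj)
  set e : ℝ := A * (b * (ε * (3 * m * ε / δ) ^ m) + δ / τ ^ (m + 1)) with he
  have hdefect : ∀ t ∈ Icc (0 : ℝ) 1, ‖deriv P t - interpField f m (P t)‖ ≤ e := by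
    intro t ht
    refine hinterp (fun t => deriv P t - interpField f m (P t)) 0 t (2 * τ - m - 1) τ δ _
      (by positivity) (by push_cast; linarith) hX2 hbound hnodes ?_ (by positivity)
    intro i hi
    have hi' : (i : ℝ) ≤ m + 1 := by exact_mod_cast hi
    have hcast : (t : ℂ) - (0 + (i : ℂ)) = ((t - i : ℝ) : ℂ) := by push_cast; ring
    have hti : |t - i| ≤ m + 1 := by
      rw [abs_le]
      constructor <;> linarith [ht.1, ht.2, (i.cast_nonneg : (0 : ℝ) ≤ i)]
    rw [hcast, Complex.norm_real, Real.norm_eq_abs]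
    exact ⟨hti, by linarith⟩
  have hL : LipschitzOnWith 1 (interpField f m) (closedBall x (δ / 6)) := by
    refine (lipschitzOnWith_closedBall_of_norm_le (by linarith) hX hXε).weaken ?_
    rw [Real.toNNReal_le_one, div_le_one (by linarith)]
    linarith
  have hnt : ∀ t ∈ Icc (0 : ℝ) 1, ‖(t : ℂ)‖ ≤ 2 * τ - m := fun t ht => by
    rw [Complex.norm_real, Real.norm_of_nonneg ht.1]
    linarith [ht.2]
  have hreal (t : ℝ) : HasDerivAt (fun s : ℝ => P s) (deriv P t) t := by
    simpa [Function.comp_def] using (hPd t).hasDerivAt.scomp t Complex.ofRealCLM.hasDerivAt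
  have hgron := dist_le_of_approx_trajectories_ODE_of_mem (v := fun _ => interpField f m)
    (s := fun _ => closedBall x (δ / 6)) (K := 1) (a := 0) (b := 1) (f := fun s : ℝ => P s)
    (g := γ) (f' := fun s => deriv P s) (g' := fun s => interpField f m (γ s))
    (εf := e) (εg := 0) (δ := 0) (fun _ _ => hL)
    (fun t _ => (hreal t).continuousAt.continuousWithinAt)
    (fun t _ => (hreal t).hasDerivWithinAt)
    (fun t ht => by rw [dist_eq_norm]; exact hdefect t ⟨ht.1, ht.2.le⟩)
    (fun t ht => hPmem t (hnt t ⟨ht.1, ht.2.le⟩))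
    hγ.continuousOn (fun t ht => hγ.hasDerivWithinAt_Ici ht) (fun t _ => by simp)
    (fun t ht => by
      rw [mem_closedBall, dist_eq_norm]
      have := hγ.norm_sub_le hXε ⟨ht.1, ht.2.le⟩
      nlinarith [ht.2])
    (by
      have := newtonCurve_natCast f m (Nat.zero_le m) x
      simp only [Nat.cast_zero, Function.iterate_zero_apply] at this
      simp [hP, this, hγ.1]) 1 (by simp)
  have hP1 : P ((1 : ℝ) : ℂ) = f x := by
    simpa using newtonCurve_natCast f m hm x
  rw [hP1, gronwallBound_of_K_ne_0 (by simp), dist_comm, dist_eq_norm] at hgron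
  refine hgron.trans_eq ?_
  have h1 : ε * (3 * m * ε / δ) ^ m = (3 * m / δ) ^ m * ε ^ (m + 1) := by
    rw [pow_succ, show 3 * m * ε / δ = 3 * m / δ * ε by ring, mul_pow]; ring
  have h2 : δ / τ ^ (m + 1) = δ / (δ / (12 * m)) ^ (m + 1) * ε ^ (m + 1) := by
    rw [hτ, ← div_div, div_pow (δ / (12 * m)) ε, div_div_eq_mul_div]; ring
  rw [he, h1, h2]
  simp
  ring

end OrderOfContact

/-! ### The family joining the identity to `f` -/

section Family

variable {E : Type*} [NormedAddCommGroup E] [NormedSpace ℂ E]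

theorem analyticOnNhd_interpField {f : E → E} {x : E} {δ ε : ℝ}
    (hf : AnalyticOnNhd ℂ f (ball x δ)) (hε : ∀ y ∈ ball x δ, ‖f y - y‖ ≤ ε) (h0 : 0 ≤ ε) {N : ℕ}
    (hNε : δ / 3 + N * ε ≤ δ) {m : ℕ} (hm : m ≤ N + 1) :
    AnalyticOnNhd ℂ (interpField f m) (ball x (δ / 3)) := fun y hy =>
  analyticAt_interpField m fun j hj => by
    have hj' : (j : ℝ) * ε ≤ N * ε := by gcongr; omega
    exact hf _ (ball_subset_ball (by linarith) (iterate_mem_ball hε h0 hy j (by linarith)))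

/-- The family `y + μ (f y - y)` which joins the identity (`μ = 0`) to `f` (`μ = 1`). -/
def scaledMap (f : E → E) (μ : ℂ) (y : E) : E := y + μ • (f y - y)

theorem scaledMap_one (f : E → E) : scaledMap f 1 = f := by ext y; simp [scaledMap]

theorem norm_scaledMap_sub_le {f : E → E} {s : Set E} {ε : ℝ} (hε : ∀ y ∈ s, ‖f y - y‖ ≤ ε)
    (μ : ℂ) : ∀ y ∈ s, ‖scaledMap f μ y - y‖ ≤ ‖μ‖ * ε := fun y hy => by
  rw [scaledMap, add_sub_cancel_left, norm_smul]
  gcongr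
  exact hε y hy

theorem analyticOnNhd_scaledMap {f : E → E} {s : Set E} (hf : AnalyticOnNhd ℂ f s) (μ : ℂ) :
    AnalyticOnNhd ℂ (scaledMap f μ) s :=
  analyticOnNhd_id.add (analyticOnNhd_const.smul (hf.sub analyticOnNhd_id))

/-- The map of `ℂ × E` which acts as `scaledMap f μ` on the slice over `μ`. Its finite differences
are those of the slices, so that joint analyticity in `μ` and `y` needs no separate argument. -/
def suspension (f : E → E) (p : ℂ × E) : ℂ × E := (p.1, scaledMap f p.1 p.2)

theorem suspension_iterate (f : E → E) (k : ℕ) (μ : ℂ) (y : E) :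
    (suspension f)^[k] (μ, y) = (μ, (scaledMap f μ)^[k] y) := by
  induction k generalizing y with
  | zero => rfl
  | succ k ih => exact ih _

theorem analyticAt_suspension {f : E → E} {μ : ℂ} {y : E} (hf : AnalyticAt ℂ f y) :
    AnalyticAt ℂ (suspension f) (μ, y) := by
  have h : AnalyticAt ℂ (fun p : ℂ × E => f p.2) (μ, y) :=
    AnalyticAt.fun_comp (f := fun p : ℂ × E => p.2) hf analyticAt_snd
  exact analyticAt_fst.prod (analyticAt_snd.add (analyticAt_fst.smul (h.sub analyticAt_snd)))

theorem snd_finiteDiff_suspension (f : E → E) (k : ℕ) (μ : ℂ) (y : E) :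
    (finiteDiff (suspension f) k (μ, y)).2 = finiteDiff (scaledMap f μ) k y := by
  induction k generalizing y with
  | zero => rfl
  | succ k ih => exact congrArg₂ (· - ·) (ih _) (ih _)

theorem snd_interpField_suspension (f : E → E) (m : ℕ) (p : ℂ × E) :
    (interpField (suspension f) m p).2 = interpField (scaledMap f p.1) m p.2 := by
  simp only [interpField, Prod.snd_sum, Prod.smul_snd]
  exact Finset.sum_congr rfl fun k _ => by rw [← snd_finiteDiff_suspension]

theorem differentiableOn_interpField_scaledMap {f : E → E} {x : E} {δ ε R : ℝ}
    (hf : AnalyticOnNhd ℂ f (ball x δ)) (hε : ∀ y ∈ ball x δ, ‖f y - y‖ ≤ ε) (h0 : 0 ≤ ε) {N : ℕ}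
    (hNε : δ / 3 + N * (R * ε) ≤ δ) {m : ℕ} (hm : m ≤ N + 1) :
    DifferentiableOn ℂ (fun p : ℂ × E => interpField (scaledMap f p.1) m p.2)
      (ball 0 R ×ˢ ball x (δ / 3)) := by
  rintro ⟨μ, y⟩ ⟨hμ, hy⟩
  rw [mem_ball_zero_iff] at hμ
  have h : AnalyticAt ℂ (interpField (suspension f) m) (μ, y) := by
    refine analyticAt_interpField m fun j hj => ?_
    rw [suspension_iterate]
    refine analyticAt_suspension (hf _ ?_)
    have hj' : (j : ℝ) * (‖μ‖ * ε) ≤ N * (R * ε) := by gcongr; omega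
    exact ball_subset_ball (by linarith)
      (iterate_mem_ball (norm_scaledMap_sub_le hε μ) (by positivity) hy j (by linarith))
  have h2 : AnalyticAt ℂ (fun p => (interpField (suspension f) m p).2) (μ, y) :=
    AnalyticAt.fun_comp (g := fun p : ℂ × E => p.2) analyticAt_snd h
  simp only [snd_interpField_suspension] at h2
  exact h2.differentiableAt.differentiableWithinAt

variable [CompleteSpace E] [NormedSpace ℝ E]

theorem exists_isSolution_interpField {f : E → E} {x : E} {δ ε : ℝ} (hδ : 0 < δ)
    (hf : AnalyticOnNhd ℂ f (ball x δ)) (hε : ∀ y ∈ ball x δ, ‖f y - y‖ ≤ ε) (h0 : 0 ≤ ε) {N : ℕ}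
    (hN : 1 ≤ N) (hNε : 6 * N * ε < δ) {m : ℕ} (hm : m ≤ N + 1) :
    ∃ γ, IsSolution (interpField f m) (ball x (δ / 3)) 1 x γ := by
  have hN' : (1 : ℝ) ≤ N := by exact_mod_cast hN
  have hK := norm_interpField_le hδ hf.differentiableOn hε h0 hN hNε.le hm
  have hKδ : 2 * ε < δ / 3 := by nlinarith
  exact exists_isSolution_ball (by positivity) hKδ hK (lipschitzOnWith_closedBall_of_norm_le hKδ
    (analyticOnNhd_interpField hf hε h0 (by nlinarith) hm).differentiableOn hK)

variable [IsScalarTower ℝ ℂ E]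

/-- The error of the time-one map, `ψ μ = γ_μ(1) - f_μ(x)` for the family `f_μ` joining the
identity to `f`, is holomorphic and bounded by `3εR` for `|μ| < R = δ / (6Nε)` and vanishes to
order `N + 2` at the origin. The claim is the Schwarz lemma for `ψ` at `μ = 1`. -/
theorem norm_solution_sub_le {f : E → E} {x : E} {δ ε : ℝ} (hδ : 0 < δ)
    (hf : AnalyticOnNhd ℂ f (ball x δ)) (hε : ∀ y ∈ ball x δ, ‖f y - y‖ ≤ ε) (h0 : 0 < ε) {N : ℕ}
    (hN : 1 ≤ N) (hNε : 6 * N * ε < δ) {γ : ℝ → E}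
    (hγ : IsSolution (interpField f (N + 1)) (ball x (δ / 3)) 1 x γ) :
    ‖γ 1 - f x‖ ≤ 3 * ε * (6 * N * ε / δ) ^ (N + 1) := by
  have hN' : (1 : ℝ) ≤ N := by exact_mod_cast hN
  set R : ℝ := δ / (6 * N * ε) with hR
  have hR1 : 1 < R := by rw [hR, lt_div_iff₀ (by positivity)]; linarith
  have hRε : 6 * N * (R * ε) = δ := by rw [hR]; field_simp
  have hx : x ∈ ball x δ := mem_ball_self hδ
  have hμε : ∀ μ ∈ ball (0 : ℂ) R, 6 * N * (‖μ‖ * ε) < δ := fun μ hμ => by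
    rw [mem_ball_zero_iff] at hμ
    rw [← hRε]
    gcongr
  have hfμ (μ : ℂ) := norm_scaledMap_sub_le hε μ
  have haμ (μ : ℂ) := analyticOnNhd_scaledMap hf μ
  have hXμ : ∀ μ ∈ ball (0 : ℂ) R, ∀ y ∈ ball x (δ / 3),
      ‖interpField (scaledMap f μ) (N + 1) y‖ ≤ 2 * (‖μ‖ * ε) := fun μ hμ =>
    norm_interpField_le hδ (haμ μ).differentiableOn (hfμ μ) (by positivity) hN (hμε μ hμ).le le_rfl
  -- solutions are chosen for all `μ`, with the given `γ` at `μ = 1`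
  have hex (μ : ℂ) : ∃ β : ℝ → E, (μ ∈ ball (0 : ℂ) R →
      IsSolution (interpField (scaledMap f μ) (N + 1)) (ball x (δ / 3)) 1 x β) ∧
      (μ = 1 → β = γ) := by
    by_cases h1 : μ = 1
    · subst h1
      exact ⟨γ, fun _ => by rwa [scaledMap_one], fun _ => rfl⟩
    · by_cases hμ : μ ∈ ball (0 : ℂ) R
      · obtain ⟨β, hβ⟩ := exists_isSolution_interpField hδ (haμ μ) (hfμ μ) (by positivity) hN
          (hμε μ hμ) le_rfl
        exact ⟨β, fun _ => hβ, fun h => absurd h h1⟩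
      · exact ⟨γ, fun h => absurd h hμ, fun h => absurd h h1⟩
  choose β hβ hβ1 using hex
  set ψ : ℂ → E := fun μ => β μ 1 - scaledMap f μ x with hψ
  have hbound : ∀ μ ∈ ball (0 : ℂ) R, ‖ψ μ‖ ≤ 3 * (‖μ‖ * ε) := fun μ hμ => by
    have h1 := (hβ μ hμ).norm_sub_le (hXμ μ hμ) (t := 1) (by simp)
    have h2 := hfμ μ x hx
    have h3 : ψ μ = (β μ 1 - x) - (scaledMap f μ x - x) := by simp [hψ]
    rw [h3]
    exact (norm_sub_le _ _).trans (by linarith)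
  have hR0 : (0 : ℂ) ∈ ball (0 : ℂ) R := mem_ball_self (by linarith)
  have hψ0 : ψ 0 = 0 := by simpa using hbound 0 hR0
  have hjoint : DifferentiableOn ℂ (fun p : ℂ × E => interpField (scaledMap f p.1) (N + 1) p.2)
      (ball 0 R ×ˢ ball x (δ / 3)) :=
    differentiableOn_interpField_scaledMap hf hε h0.le (by linarith) le_rfl
  have hdiff : DifferentiableOn ℂ ψ (ball 0 R) := by
    refine DifferentiableOn.sub ?_ (by unfold scaledMap; fun_prop)
    intro μ hμ
    -- on a slightly smaller disc the vector fields have a common bound less than `δ / 3`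
    obtain ⟨R', hμR', hR'R⟩ := exists_between (mem_ball_zero_iff.1 hμ)
    have hsub : ball (0 : ℂ) R' ⊆ ball 0 R := ball_subset_ball hR'R.le
    have hR'0 : 0 < R' := (norm_nonneg μ).trans_lt hμR'
    have hlt : 6 * N * (R' * ε) < 6 * N * (R * ε) := by gcongr
    have := differentiableOn_solution_one (Y := fun μ => interpField (scaledMap f μ) (N + 1))
      (γ := β) (K := 2 * (R' * ε)) (R := R') (r := δ / 3) (x := x) (by positivity)
      (by nlinarith [mul_pos hR'0 h0])
      (hjoint.mono (prod_mono_left hsub))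
      (fun ν hν y hy => (hXμ ν (hsub hν) y hy).trans (by
        rw [mem_ball_zero_iff] at hν; gcongr))
      (fun ν hν => hβ ν (hsub hν))
    exact (this.differentiableAt (isOpen_ball.mem_nhds (by simpa using hμR'))).differentiableWithinAt
  have horder : (fun μ => ψ μ - ψ 0) =o[𝓝 0] fun μ : ℂ => ‖μ - 0‖ ^ (N + 1) := by
    obtain ⟨C, c, hc, hC⟩ := exists_norm_solution_sub_le (E := E) (by omega : 1 ≤ N + 1) hδ
    have hO : ψ =O[𝓝 0] fun μ : ℂ => ‖μ‖ ^ (N + 2) := by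
      refine Asymptotics.IsBigO.of_bound (|C| * ε ^ (N + 2)) ?_
      have hsmall : ∀ᶠ μ : ℂ in 𝓝 0, ‖μ‖ < c / ε := by
        filter_upwards [ball_mem_nhds (0 : ℂ) (by positivity : 0 < c / ε)] with μ hμ
        simpa using hμ
      filter_upwards [hsmall, isOpen_ball.mem_nhds hR0] with μ hμ hμR
      rcases eq_or_ne μ 0 with rfl | hne
      · simp [hψ0]
      · have hμ0 : 0 < ‖μ‖ := norm_pos_iff.2 hne
        have := hC (scaledMap f μ) x (‖μ‖ * ε) (β μ) (by positivity)
          ((lt_div_iff₀ h0).1 hμ).le (haμ μ).differentiableOn (hfμ μ)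
          (analyticOnNhd_interpField (haμ μ) (hfμ μ) (by positivity)
            (by nlinarith [hμε μ hμR]) le_rfl).differentiableOn (hβ μ hμR)
        refine this.trans ?_
        rw [mul_pow, norm_pow, norm_norm]
        have : C * (‖μ‖ ^ (N + 1 + 1) * ε ^ (N + 1 + 1)) ≤
            |C| * (‖μ‖ ^ (N + 1 + 1) * ε ^ (N + 1 + 1)) := by gcongr; exact le_abs_self C
        linarith
    simp only [hψ0, sub_zero]
    refine hO.trans_isLittleO ?_
    have := (Asymptotics.isLittleO_pow_pow (𝕜 := ℂ) (by omega : N + 1 < N + 2)).norm_norm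
    simpa only [norm_pow] using this
  have hschwarz := Complex.dist_le_mul_div_pow_of_mapsTo_ball_of_isLittleO hdiff
    (R₂ := 3 * (R * ε)) (fun μ hμ => by
      rw [hψ0, mem_closedBall_zero_iff]
      refine (hbound μ hμ).trans ?_
      rw [mem_ball_zero_iff] at hμ
      gcongr) horder (z := 1) (by simpa using hR1)
  have h1 : ψ 1 = γ 1 - f x := by simp [hψ, hβ1 1 rfl, scaledMap_one]
  rw [hψ0, dist_zero_right, h1, dist_zero_right, norm_one] at hschwarz
  refine hschwarz.trans_eq ?_
  have h2 : 6 * N * ε / δ = 1 / R := by rw [hR, one_div_div]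
  rw [h2, pow_succ (1 / R) (N + 1)]
  field_simp

end Family

/-! ### Embedding into a flow -/

theorem theorem1 (n : ℕ) (D₀ : Set (Fin n → ℂ)) (δ ε : ℝ) (hδ : 0 < δ)
    (f : (Fin n → ℂ) → (Fin n → ℂ))
    (hf : AnalyticOnNhd ℂ f (Metric.thickening δ D₀))
    (hε : IsLUB ((fun x => ‖f x - x‖) '' Metric.thickening δ D₀) ε)
    (hεδ : ε / δ ≤ 1 / (6 * Real.exp 1)) :
    (∀ m : ℕ, 2 ≤ m → (ε ≠ 0 → (m : ℝ) ≤ δ / (6 * Real.exp 1 * ε) + 1) →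
      (∀ x ∈ Metric.thickening (δ / 3) D₀, ∀ k < m, f^[k] x ∈ Metric.thickening δ D₀) ∧
      AnalyticOnNhd ℂ (interpField f m) (Metric.thickening (δ / 3) D₀) ∧
      (∀ x ∈ Metric.thickening (δ / 3) D₀, ‖interpField f m x‖ ≤ 2 * ε) ∧
      ∃ Φ : ℝ → (Fin n → ℂ) → (Fin n → ℂ),
        IsFlow (interpField f m) (Metric.thickening (δ / 3) D₀) D₀ 1 Φ ∧
        ∀ x ∈ D₀, ‖Φ 1 x - f x‖ ≤ 3 * ε * (6 * ((m : ℝ) - 1) * ε / δ) ^ m) ∧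
    (ε ≠ 0 → ∀ m : ℕ, m = ⌊δ / (6 * Real.exp 1 * ε)⌋₊ + 1 →
      2 ≤ m ∧ (m : ℝ) ≤ δ / (6 * Real.exp 1 * ε) + 1 ∧
      ∃ Φ : ℝ → (Fin n → ℂ) → (Fin n → ℂ),
        IsFlow (interpField f m) (Metric.thickening (δ / 3) D₀) D₀ 1 Φ ∧
        ∀ x ∈ D₀, ‖Φ 1 x - f x‖ ≤ 3 * ε * Real.exp (-(δ / (6 * Real.exp 1 * ε)))) := by
  have hle : ∀ y ∈ thickening δ D₀, ‖f y - y‖ ≤ ε := fun y hy => hε.1 (mem_image_of_mem _ hy)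
  -- `ε` is a least upper bound, which rules out `D₀ = ∅`
  have hne : (thickening δ D₀).Nonempty := image_nonempty.1 hε.nonempty
  have h0 : 0 ≤ ε := (norm_nonneg _).trans (hle _ hne.some_mem)
  have he : 1 < Real.exp 1 := Real.one_lt_exp_iff.2 one_pos
  -- everything happens on balls about the points of `D₀`
  have hball : ∀ x ∈ D₀, ∀ r, ball x r ⊆ thickening r D₀ := fun x hx r =>
    ball_subset_thickening hx r
  have hmain : ∀ m : ℕ, 2 ≤ m → (ε ≠ 0 → (m : ℝ) ≤ δ / (6 * Real.exp 1 * ε) + 1) →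
      (∀ x ∈ thickening (δ / 3) D₀, ∀ k < m, f^[k] x ∈ thickening δ D₀) ∧
      AnalyticOnNhd ℂ (interpField f m) (thickening (δ / 3) D₀) ∧
      (∀ x ∈ thickening (δ / 3) D₀, ‖interpField f m x‖ ≤ 2 * ε) ∧
      ∃ Φ : ℝ → (Fin n → ℂ) → (Fin n → ℂ),
        IsFlow (interpField f m) (thickening (δ / 3) D₀) D₀ 1 Φ ∧
        ∀ x ∈ D₀, ‖Φ 1 x - f x‖ ≤ 3 * ε * (6 * ((m : ℝ) - 1) * ε / δ) ^ m := by
    intro m hm2 hm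
    obtain ⟨N, rfl⟩ : ∃ N, m = N + 1 := ⟨m - 1, by omega⟩
    have hN : 1 ≤ N := by omega
    have hN' : (1 : ℝ) ≤ N := by exact_mod_cast hN
    have hNε : 6 * N * ε < δ := by
      rcases h0.eq_or_lt with h | h
      · simpa [← h] using hδ
      · have h1 := hm h.ne'
        push_cast at h1
        have h2 : (N : ℝ) ≤ δ / (6 * Real.exp 1 * ε) := by linarith
        rw [le_div_iff₀ (by positivity)] at h2
        nlinarith [mul_pos (by linarith : (0 : ℝ) < N) h]
    have hK : ∀ x ∈ thickening (δ / 3) D₀, ‖interpField f (N + 1) x‖ ≤ 2 * ε := fun y hy => by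
      obtain ⟨x, hx, hyx⟩ := mem_thickening_iff.1 hy
      exact norm_interpField_le hδ (hf.mono (hball x hx δ)).differentiableOn
        (fun z hz => hle z (hball x hx δ hz)) h0 hN hNε.le le_rfl y hyx
    have hA : AnalyticOnNhd ℂ (interpField f (N + 1)) (thickening (δ / 3) D₀) := fun y hy => by
      obtain ⟨x, hx, hyx⟩ := mem_thickening_iff.1 hy
      exact analyticOnNhd_interpField (hf.mono (hball x hx δ))
        (fun z hz => hle z (hball x hx δ hz)) h0 (by linarith) le_rfl y hyx
    refine ⟨?_, hA, hK, ?_⟩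
    · intro y hy k hk
      obtain ⟨x, hx, hyx⟩ := mem_thickening_iff.1 hy
      have hk' : (k : ℝ) * ε ≤ N * ε := by gcongr; omega
      exact hball x hx δ (ball_subset_ball (by linarith)
        (iterate_mem_ball (fun z hz => hle z (hball x hx δ hz)) h0 hyx k (by linarith)))
    · have hex (x : Fin n → ℂ) : ∃ γ : ℝ → Fin n → ℂ, x ∈ D₀ →
          IsSolution (interpField f (N + 1)) (ball x (δ / 3)) 1 x γ := by
        by_cases hx : x ∈ D₀
        · obtain ⟨γ, hγ⟩ := exists_isSolution_interpField hδ (hf.mono (hball x hx δ))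
            (fun z hz => hle z (hball x hx δ hz)) h0 hN hNε le_rfl
          exact ⟨γ, fun _ => hγ⟩
        · exact ⟨0, fun h => absurd h hx⟩
      choose γ hγ using hex
      refine ⟨fun t x => γ x t, fun x hx => ?_, fun x hx => ?_⟩
      · have hsol : IsSolution (interpField f (N + 1)) (thickening (δ / 3) D₀) 1 x (γ x) :=
          ⟨(hγ x hx).1, fun t ht =>
            ⟨hball x hx _ ((hγ x hx).2 t ht).1, ((hγ x hx).2 t ht).2⟩⟩
        refine ⟨hsol, fun T hT γ' hγ' => ?_⟩
        exact hsol.eqOn (by positivity) hK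
          (lipschitzOnWith_closedBall_of_norm_le (by nlinarith : 2 * ε < δ / 3)
            (hA.mono (hball x hx _)).differentiableOn fun y hy => hK y (hball x hx _ hy))
          hγ' hT.2 le_rfl
      · have hfx := hle x (self_subset_thickening hδ D₀ hx)
        have hcast : ((N + 1 : ℕ) : ℝ) - 1 = N := by push_cast; ring
        rw [hcast]
        rcases h0.eq_or_lt with h | h
        · -- for `ε = 0` the vector field vanishes and `f` is the identity
          have h1 := (hγ x hx).norm_sub_le
            (fun y hy => hK y (hball x hx _ hy)) (t := 1) (by simp)
          have h2 : γ x 1 - f x = (γ x 1 - x) - (f x - x) := by abel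
          change ‖γ x 1 - f x‖ ≤ _
          rw [h2, ← h]
          rw [← h] at h1 hfx
          refine (norm_sub_le _ _).trans ?_
          simp only [mul_zero, zero_mul] at h1 ⊢
          linarith
        · exact norm_solution_sub_le hδ (hf.mono (hball x hx δ))
            (fun z hz => hle z (hball x hx δ hz)) h hN hNε (hγ x hx)
  refine ⟨hmain, fun hε0 m hm => ?_⟩
  have hpos : 0 < ε := lt_of_le_of_ne h0 (Ne.symm hε0)
  set M : ℝ := δ / (6 * Real.exp 1 * ε) with hM
  have hM1 : 1 ≤ M := by
    rw [div_le_div_iff₀ hδ (by positivity)] at hεδ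
    rw [hM, le_div_iff₀ (by positivity)]
    linarith
  have hm2 : 2 ≤ m := by
    have : 1 ≤ ⌊M⌋₊ := Nat.le_floor (by simpa using hM1)
    omega
  have hmM : (m : ℝ) ≤ M + 1 := by
    have := Nat.floor_le (by linarith : 0 ≤ M)
    rw [hm]
    push_cast
    linarith
  have hMm : M ≤ m := by
    have := (Nat.lt_floor_add_one M).le
    rw [hm]
    exact_mod_cast this
  refine ⟨hm2, hmM, ?_⟩
  obtain ⟨-, -, -, Φ, hΦ, hb⟩ := hmain m hm2 fun _ => hmM
  refine ⟨Φ, hΦ, fun x hx => (hb x hx).trans ?_⟩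
  have hm1 : (0 : ℝ) ≤ m - 1 := by
    have : (2 : ℝ) ≤ m := by exact_mod_cast hm2
    linarith
  have hq : 6 * ((m : ℝ) - 1) * ε / δ ≤ Real.exp (-1) := by
    have h1 : (m : ℝ) - 1 ≤ δ / (6 * Real.exp 1 * ε) := by linarith
    rw [le_div_iff₀ (by positivity)] at h1
    rw [Real.exp_neg, div_le_iff₀ hδ, inv_mul_eq_div, le_div_iff₀ (by positivity)]
    linarith
  gcongr
  calc _ ≤ Real.exp (-1) ^ m := by gcongr
    _ = Real.exp (-m) := by rw [← Real.exp_nat_mul]; simp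
    _ ≤ Real.exp (-M) := by gcongr
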